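/- Let $G$ be a (real, finite-dimensional) Lie group, $V$ a finite-dimensional real vector space and $\Phi:G\to \mathrm{Aut}(V)$ a representation, i.e. a smooth group homomorphism. The tangent bundle $TG$ is a group under the tangent maps of the multiplication and inversion of $G$ (with $T(G\times G)\cong TG\times TG$). The tangent bundle $TV$ is a real vector space under $$X\oplus Y=(T\tau_y)X+(T\tau_x)Y,\qquad \lambda\bullet X=(T\sigma_\lambda)X\qquad (X\in T_xV,\ Y\in T_yV,\ \lambda\in\mathbb R),$$ where $\tau_x$ is translation by $x$ and $\sigma_\lambda$ is multiplication by $\lambda$; the trivialization $\psi:TV\to V\times V$ is a linear isomorphism. The prolongation of $\Phi$ is the representation $\widetilde\Phi:TG\to\mathrm{Aut}(TV)$ given, for $X_a\in T_aG$ and in the trivialization $\psi$, by $$\widetilde\Phi(X_a)=\begin{pmatrix}\Phi(a)&0\\ B\,\Phi(a)&\Phi(a)\end{pmatrix},\qquad B=TR_{\Phi(a)^{-1}}\big(T\Phi(X_a)\big)\in \mathrm{Lie}(\mathrm{Aut}(V))=\mathrm{End}(V),$$ where $R_g$ is right translation by $g$ in $\mathrm{Aut}(V)$. A representation is called irreducible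 if its only invariant subspaces are $\{0\}$ and the whole space. If $\widetilde\Phi$ is irreducible, then $\Phi$ is irreducible. The converse is not true: the representation $$\Phi:S^1\to\mathrm{Aut}(\mathbb R^2),\qquad \Phi(a,b)(x,y)=(ax+by,\,-bx+ay)$$ is irreducible, but its prolongation $\widetilde\Phi$ is not irreducible. -/

import Mathlib

open scoped Manifold ContDiff

noncomputable section

namespace Prolongation

/-! ### The tangent bundle of a Lie group as a group -/

section TangentGroup

variable {E : Type*} [NormedAddCommGroup E] [NormedSpace ℝ E]
  {H : Type*} [TopologicalSpace H] {I : ModelWithCorners ℝ E H}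

/-- The coordinates of a tangent vector in the model space. -/
def vec {M : Type*} [TopologicalSpace M] [ChartedSpace H M] (X : TangentBundle I M) : E := X.2

theorem tangent_ext {M : Type*} [TopologicalSpace M] [ChartedSpace H M] {X Y : TangentBundle I M}
    (h₁ : X.1 = Y.1) (h₂ : vec X = vec Y) : X = Y := by
  obtain ⟨x, v⟩ := X
  obtain ⟨y, w⟩ := Y
  dsimp at h₁
  subst h₁
  exact congrArg _ h₂

variable {G : Type*} [TopologicalSpace G] [ChartedSpace H G] [Group G] [LieGroup I ∞ G]

/-- The product on `TG` is the tangent map of the product of `G`, through `TG × TG ≅ T(G × G)`. -/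
instance tangentMul : Mul (TangentBundle I G) where
  mul X Y := tangentMap (I.prod I) I (fun q : G × G => q.1 * q.2)
    ((equivTangentBundleProd I G I G).symm (X, Y))

/-- The unit of `TG` is the zero tangent vector at the unit of `G`. -/
instance tangentOne : One (TangentBundle I G) where
  one := ⟨1, 0⟩

/-- The inverse on `TG` is the tangent map of the inverse of `G`. -/
instance tangentInv : Inv (TangentBundle I G) where
  inv X := tangentMap I I (fun a : G => a⁻¹) X

theorem mdiff_mul (p : G × G) :
    MDifferentiableAt (I.prod I) I (fun q : G × G => q.1 * q.2) p :=
  (contMDiff_mul I ∞).mdifferentiable (by simp) p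

theorem mdiff_mul_left (a x : G) : MDifferentiableAt I I (fun z : G => a * z) x :=
  (contMDiff_mul_left (I := I) (n := ∞)).mdifferentiable (by simp) x

theorem mdiff_mul_right (a x : G) : MDifferentiableAt I I (fun z : G => z * a) x :=
  (contMDiff_mul_right (I := I) (n := ∞)).mdifferentiable (by simp) x

theorem mdiff_inv (x : G) : MDifferentiableAt I I (fun z : G => z⁻¹) x :=
  (contMDiff_inv I ∞).mdifferentiable (by simp) x

/-- The derivative of a left translation, seen on the model space. -/
def dL (I : ModelWithCorners ℝ E H) (a x : G) : E →L[ℝ] E := mfderiv I I (fun z : G => a * z) x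

/-- The derivative of a right translation, seen on the model space. -/
def dR (I : ModelWithCorners ℝ E H) (a x : G) : E →L[ℝ] E := mfderiv I I (fun z : G => z * a) x

theorem mul_fst (X Y : TangentBundle I G) : (X * Y).1 = X.1 * Y.1 := rfl

theorem mul_snd (X Y : TangentBundle I G) :
    vec (X * Y) = dR I Y.1 X.1 (vec X) + dL I X.1 Y.1 (vec Y) :=
  mfderiv_prod_eq_add_apply (v := ((X.2, Y.2) : E × E)) (mdiff_mul (I := I) (X.1, Y.1))

theorem dL_mul (a b x : G) (v : E) : dL I (a * b) x v = dL I a (b * x) (dL I b x v) := by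
  have h := mfderiv_comp (I := I) (I' := I) (I'' := I) x (mdiff_mul_left (I := I) a (b * x))
    (mdiff_mul_left (I := I) b x)
  have e : (fun z : G => a * z) ∘ (fun z : G => b * z) = fun z => a * b * z := by
    funext z; simp [mul_assoc]
  have h' := (mfderiv_congr (I := I) (I' := I) (x := x) e).symm.trans h
  exact congrArg (fun L : E →L[ℝ] E => L v) h'

theorem dR_mul (a b x : G) (v : E) : dR I (a * b) x v = dR I b (x * a) (dR I a x v) := by
  have h := mfderiv_comp (I := I) (I' := I) (I'' := I) x (mdiff_mul_right (I := I) b (x * a))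
    (mdiff_mul_right (I := I) a x)
  have e : (fun z : G => z * b) ∘ (fun z : G => z * a) = fun z => z * (a * b) := by
    funext z; simp [mul_assoc]
  have h' := (mfderiv_congr (I := I) (I' := I) (x := x) e).symm.trans h
  exact congrArg (fun L : E →L[ℝ] E => L v) h'

theorem dL_dR (a b x : G) (v : E) : dL I a (x * b) (dR I b x v) = dR I b (a * x) (dL I a x v) := by
  have h₁ := mfderiv_comp (I := I) (I' := I) (I'' := I) x (mdiff_mul_left (I := I) a (x * b))
    (mdiff_mul_right (I := I) b x)
  have h₂ := mfderiv_comp (I := I) (I' := I) (I'' := I) x (mdiff_mul_right (I := I) b (a * x))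
    (mdiff_mul_left (I := I) a x)
  have e : (fun z : G => a * z) ∘ (fun z : G => z * b)
      = (fun z : G => z * b) ∘ (fun z : G => a * z) := by
    funext z; simp [mul_assoc]
  have h' := h₁.symm.trans ((mfderiv_congr (I := I) (I' := I) (x := x) e).trans h₂)
  exact congrArg (fun L : E →L[ℝ] E => L v) h'

theorem dL_one (x : G) (v : E) : dL I 1 x v = v := by
  have e : (fun z : G => 1 * z) = id := by funext z; simp
  have h := (mfderiv_congr (I := I) (I' := I) (x := x) e).trans (mfderiv_id (I := I))
  exact congrArg (fun L : E →L[ℝ] E => L v) h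

theorem dR_one (x : G) (v : E) : dR I 1 x v = v := by
  have e : (fun z : G => z * 1) = id := by funext z; simp
  have h := (mfderiv_congr (I := I) (I' := I) (x := x) e).trans (mfderiv_id (I := I))
  exact congrArg (fun L : E →L[ℝ] E => L v) h

theorem inv_mul_snd (X : TangentBundle I G) : vec (X⁻¹ * X) = 0 := by
  have h₁ := mfderiv_comp (I := I) (I' := I.prod I) (I'' := I) X.1
    (f := fun z : G => (z⁻¹, id z)) (mdiff_mul (I := I) (X.1⁻¹, X.1)) ((mdiff_inv (I := I) X.1).prodMk mdifferentiableAt_id)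
  have e : (fun q : G × G => q.1 * q.2) ∘ (fun z : G => (z⁻¹, id z)) = fun _ => 1 := by
    funext z; simp
  have h₂ := h₁.symm.trans ((mfderiv_congr (I := I) (I' := I) (x := X.1) e).trans
    (mfderiv_const (I := I) (I' := I)))
  have h₃ := congrArg (fun L : E →L[ℝ] E => L X.2) h₂
  have h₄ := mfderiv_prodMk (I := I) (I' := I) (I'' := I) (mdiff_inv (I := I) X.1)
    (mdifferentiableAt_id (I := I) (x := X.1))
  rw [mfderiv_id] at h₄
  rw [h₄] at h₃
  exact h₃

/-- The tangent bundle of a Lie group is a group. -/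
instance tangentGroup : Group (TangentBundle I G) :=
  Group.ofLeftAxioms
    (fun X Y Z => by
      refine tangent_ext (mul_assoc X.1 Y.1 Z.1) ?_
      rw [mul_snd, mul_snd X (Y * Z), mul_snd, mul_snd, mul_fst, mul_fst Y Z, map_add, map_add,
        dR_mul, dL_mul, dL_dR, add_assoc])
    (fun X => by
      refine tangent_ext (one_mul X.1) ?_
      rw [mul_snd]
      change dR I X.1 1 (0 : E) + dL I 1 X.1 (vec X) = _
      rw [map_zero, zero_add, dL_one])
    (fun X => tangent_ext (inv_mul_cancel X.1) (inv_mul_snd X))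

end TangentGroup

/-! ### The tangent bundle of a vector space as a vector space -/

section TangentVectorSpace

variable {V : Type*} [NormedAddCommGroup V] [NormedSpace ℝ V]

/-- For `X ∈ T_x V` and `Y ∈ T_y V`, the sum is `(Tτ_y) X + (Tτ_x) Y ∈ T_{x+y} V`,
where `τ` denotes translations. -/
instance tangentAdd : Add (TangentBundle 𝓘(ℝ, V) V) where
  add X Y := ⟨X.1 + Y.1,
    vec (tangentMap 𝓘(ℝ, V) 𝓘(ℝ, V) (fun p : V => p + Y.1) X) +
      vec (tangentMap 𝓘(ℝ, V) 𝓘(ℝ, V) (fun p : V => X.1 + p) Y)⟩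

/-- `c • X = (Tσ_c) X`, where `σ_c` is the multiplication by the scalar `c`. -/
instance tangentSMul : SMul ℝ (TangentBundle 𝓘(ℝ, V) V) where
  smul c X := tangentMap 𝓘(ℝ, V) 𝓘(ℝ, V) (fun p : V => c • p) X

/-- The trivialization of `TV`, as a bijection. -/
def trivEquiv (V : Type*) [NormedAddCommGroup V] [NormedSpace ℝ V] :
    TangentBundle 𝓘(ℝ, V) V ≃ V × V where
  toFun X := (X.1, vec X)
  invFun q := ⟨q.1, q.2⟩
  left_inv _ := rfl
  right_inv _ := rfl

theorem trivEquiv_add (X Y : TangentBundle 𝓘(ℝ, V) V) :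
    trivEquiv V (X + Y) = trivEquiv V X + trivEquiv V Y := by
  have h₁ : mfderiv 𝓘(ℝ, V) 𝓘(ℝ, V) (fun p : V => p + Y.1) X.1 = ContinuousLinearMap.id ℝ V := by
    rw [mfderiv_eq_fderiv, fderiv_add_const]; exact fderiv_id
  have h₂ : mfderiv 𝓘(ℝ, V) 𝓘(ℝ, V) (fun p : V => X.1 + p) Y.1 = ContinuousLinearMap.id ℝ V := by
    rw [mfderiv_eq_fderiv, fderiv_const_add]; exact fderiv_id
  refine Prod.ext rfl ?_
  exact congrArg₂ (fun a b : V => a + b) (congrArg (fun L : V →L[ℝ] V => L X.2) h₁)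
    (congrArg (fun L : V →L[ℝ] V => L Y.2) h₂)

theorem trivEquiv_smul (c : ℝ) (X : TangentBundle 𝓘(ℝ, V) V) :
    trivEquiv V (c • X) = c • trivEquiv V X := by
  have h : mfderiv 𝓘(ℝ, V) 𝓘(ℝ, V) (fun p : V => c • p) X.1 = c • ContinuousLinearMap.id ℝ V := by
    rw [mfderiv_eq_fderiv, fderiv_fun_const_smul differentiableAt_fun_id]
    exact congrArg _ fderiv_id
  refine Prod.ext rfl ?_
  exact congrArg (fun L : V →L[ℝ] V => L X.2) h

instance tangentZero : Zero (TangentBundle 𝓘(ℝ, V) V) := ⟨⟨0, 0⟩⟩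

instance tangentNeg : Neg (TangentBundle 𝓘(ℝ, V) V) := ⟨fun X => (-1 : ℝ) • X⟩

theorem trivEquiv_neg (X : TangentBundle 𝓘(ℝ, V) V) : trivEquiv V (-X) = -trivEquiv V X := by
  refine (trivEquiv_smul (-1) X).trans ?_
  simp

instance tangentAddCommGroup : AddCommGroup (TangentBundle 𝓘(ℝ, V) V) :=
  { AddGroup.ofLeftAxioms
      (fun X Y Z => (trivEquiv V).injective (by simp only [trivEquiv_add, add_assoc]))
      (fun X => (trivEquiv V).injective (by
        rw [trivEquiv_add]; exact zero_add (trivEquiv V X)))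
      (fun X => (trivEquiv V).injective (by
        rw [trivEquiv_add, trivEquiv_neg, neg_add_cancel]; rfl)) with
    add_comm := fun X Y => (trivEquiv V).injective (by
      rw [trivEquiv_add, trivEquiv_add, add_comm]) }

instance tangentModule : Module ℝ (TangentBundle 𝓘(ℝ, V) V) where
  one_smul X := (trivEquiv V).injective (by rw [trivEquiv_smul, one_smul])
  mul_smul a b X := (trivEquiv V).injective (by simp only [trivEquiv_smul, mul_smul])
  smul_zero a := (trivEquiv V).injective (by
    rw [trivEquiv_smul]; exact smul_zero a)
  smul_add a X Y := (trivEquiv V).injective (by simp only [trivEquiv_smul, trivEquiv_add, smul_add])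
  add_smul a b X := (trivEquiv V).injective (by simp only [trivEquiv_smul, trivEquiv_add, add_smul])
  zero_smul X := (trivEquiv V).injective (by
    rw [trivEquiv_smul, zero_smul]; rfl)

/-- The trivialization `ψ : TV → V × V` of the tangent bundle, a linear isomorphism. -/
def triv (V : Type*) [NormedAddCommGroup V] [NormedSpace ℝ V] :
    TangentBundle 𝓘(ℝ, V) V ≃ₗ[ℝ] V × V :=
  { trivEquiv V with
    map_add' := trivEquiv_add
    map_smul' := trivEquiv_smul }

end TangentVectorSpace

/-! ### Representations and their prolongations -/

section Prolong

variable {V : Type*} [NormedAddCommGroup V] [NormedSpace ℝ V] [FiniteDimensional ℝ V]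

/-- The block operator with matrix `(a, 0; B a, a)` on `V × V`. -/
def block (a B : V →L[ℝ] V) : V × V →ₗ[ℝ] V × V where
  toFun q := (a q.1, B (a q.1) + a q.2)
  map_add' q r := by
    ext <;> simp only [Prod.fst_add, Prod.snd_add, map_add]
    abel
  map_smul' c q := by
    ext <;> simp

/-- For `Y ∈ T_a Aut(V)`, the vector `B = (T R_{a⁻¹}) Y ∈ Lie(Aut(V)) = End(V)`, so that
`Y = (T R_a) B = [a, B]`. -/
def rightTriv (Y : TangentBundle 𝓘(ℝ, V →L[ℝ] V) (V →L[ℝ] V)ˣ) : V →L[ℝ] V :=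
  vec (tangentMap 𝓘(ℝ, V →L[ℝ] V) 𝓘(ℝ, V →L[ℝ] V)
    (fun b : (V →L[ℝ] V)ˣ => b * Y.1⁻¹) Y)

/-- The map `J : T(Aut(V)) → End(TV)`, which sends `[a, B]` to the operator with matrix
`(a, 0; B a, a)` in the trivialization `ψ`. -/
def autLift (Y : TangentBundle 𝓘(ℝ, V →L[ℝ] V) (V →L[ℝ] V)ˣ) :
    Module.End ℝ (TangentBundle 𝓘(ℝ, V) V) :=
  (triv V).symm.toLinearMap ∘ₗ block (Y.1 : V →L[ℝ] V) (rightTriv Y) ∘ₗ (triv V).toLinearMap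

theorem mfderiv_unitsVal (a : (V →L[ℝ] V)ˣ) :
    HasMFDerivAt 𝓘(ℝ, V →L[ℝ] V) 𝓘(ℝ, V →L[ℝ] V)
      (Units.val : (V →L[ℝ] V)ˣ → (V →L[ℝ] V)) a
      (ContinuousLinearMap.id ℝ (V →L[ℝ] V)) := by
  refine ⟨Units.continuous_val.continuousAt, ?_⟩
  refine (hasFDerivWithinAt_id _ _).congr_of_eventuallyEq ?_ ?_
  · have h := extChartAt_target_mem_nhdsWithin (I := 𝓘(ℝ, V →L[ℝ] V)) a
    filter_upwards [h] with z hz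
    exact (extChartAt 𝓘(ℝ, V →L[ℝ] V) a).right_inv hz
  · exact (extChartAt 𝓘(ℝ, V →L[ℝ] V) a).right_inv
      ((extChartAt 𝓘(ℝ, V →L[ℝ] V) a).map_source (mem_extChartAt_source a))

variable {E : Type*} [NormedAddCommGroup E] [NormedSpace ℝ E]
  {H : Type*} [TopologicalSpace H] {I : ModelWithCorners ℝ E H}

theorem mfderiv_val_comp {M : Type*} [TopologicalSpace M] [ChartedSpace H M]
    {f : M → (V →L[ℝ] V)ˣ} {x : M} (hf : MDifferentiableAt I 𝓘(ℝ, V →L[ℝ] V) f x) (v : E) :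
    @Eq (V →L[ℝ] V) ((mfderiv I 𝓘(ℝ, V →L[ℝ] V) f x : E →L[ℝ] (V →L[ℝ] V)) v)
      ((mfderiv I 𝓘(ℝ, V →L[ℝ] V) (fun y => (f y : V →L[ℝ] V)) x : E →L[ℝ] (V →L[ℝ] V)) v) := by
  have h := (HasMFDerivAt.comp x (mfderiv_unitsVal (f x)) hf.hasMFDerivAt).mfderiv
  exact (congrArg (fun L : E →L[ℝ] (V →L[ℝ] V) => L v) h).symm

theorem dR_units (a x : (V →L[ℝ] V)ˣ) (B : V →L[ℝ] V) :
    dR 𝓘(ℝ, V →L[ℝ] V) a x B = B * (a : V →L[ℝ] V) := by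
  refine (mfderiv_val_comp (mdiff_mul_right (I := 𝓘(ℝ, V →L[ℝ] V)) a x) B).trans ?_
  have h : HasMFDerivAt 𝓘(ℝ, V →L[ℝ] V) 𝓘(ℝ, V →L[ℝ] V)
      (fun T : V →L[ℝ] V => T * (a : V →L[ℝ] V)) (x : V →L[ℝ] V)
      ((ContinuousLinearMap.mul ℝ (V →L[ℝ] V)).flip (a : V →L[ℝ] V)) :=
    (((ContinuousLinearMap.mul ℝ (V →L[ℝ] V)).flip (a : V →L[ℝ] V)).hasFDerivAt).hasMFDerivAt
  have h' := (HasMFDerivAt.comp x h (mfderiv_unitsVal x)).mfderiv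
  exact congrArg (fun L : (V →L[ℝ] V) →L[ℝ] (V →L[ℝ] V) => L B) h'

theorem dL_units (a x : (V →L[ℝ] V)ˣ) (B : V →L[ℝ] V) :
    dL 𝓘(ℝ, V →L[ℝ] V) a x B = (a : V →L[ℝ] V) * B := by
  refine (mfderiv_val_comp (mdiff_mul_left (I := 𝓘(ℝ, V →L[ℝ] V)) a x) B).trans ?_
  have h : HasMFDerivAt 𝓘(ℝ, V →L[ℝ] V) 𝓘(ℝ, V →L[ℝ] V)
      (fun T : V →L[ℝ] V => (a : V →L[ℝ] V) * T) (x : V →L[ℝ] V)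
      ((ContinuousLinearMap.mul ℝ (V →L[ℝ] V)) (a : V →L[ℝ] V)) :=
    (((ContinuousLinearMap.mul ℝ (V →L[ℝ] V)) (a : V →L[ℝ] V)).hasFDerivAt).hasMFDerivAt
  have h' := (HasMFDerivAt.comp x h (mfderiv_unitsVal x)).mfderiv
  exact congrArg (fun L : (V →L[ℝ] V) →L[ℝ] (V →L[ℝ] V) => L B) h'

theorem rightTriv_eq (Y : TangentBundle 𝓘(ℝ, V →L[ℝ] V) (V →L[ℝ] V)ˣ) :
    rightTriv Y = vec Y * ((Y.1⁻¹ : (V →L[ℝ] V)ˣ) : V →L[ℝ] V) :=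
  dR_units Y.1⁻¹ Y.1 (vec Y)

theorem rightTriv_mul (Y : TangentBundle 𝓘(ℝ, V →L[ℝ] V) (V →L[ℝ] V)ˣ) (p : V) :
    rightTriv Y ((Y.1 : V →L[ℝ] V) p) = vec Y p := by
  rw [rightTriv_eq]
  change vec Y ((((Y.1⁻¹ : (V →L[ℝ] V)ˣ) : V →L[ℝ] V) * (Y.1 : V →L[ℝ] V)) p) = _
  rw [Units.inv_mul]
  rfl

theorem autLift_apply (Y : TangentBundle 𝓘(ℝ, V →L[ℝ] V) (V →L[ℝ] V)ˣ)
    (W : TangentBundle 𝓘(ℝ, V) V) :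
    triv V (autLift Y W) = ((Y.1 : V →L[ℝ] V) W.1,
      vec Y W.1 + (Y.1 : V →L[ℝ] V) (vec W)) := by
  refine Prod.ext rfl ?_
  exact congrArg (fun v : V => v + (Y.1 : V →L[ℝ] V) (vec W)) (rightTriv_mul Y W.1)

/-- `J` is a homomorphism for the group structure of `T(Aut(V))`. -/
def autLiftHom : TangentBundle 𝓘(ℝ, V →L[ℝ] V) (V →L[ℝ] V)ˣ →*
    Module.End ℝ (TangentBundle 𝓘(ℝ, V) V) where
  toFun := autLift
  map_one' := by
    refine LinearMap.ext fun W => (triv V).injective ?_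
    rw [autLift_apply]
    refine Prod.ext rfl ?_
    exact zero_add (vec W)
  map_mul' X Y := by
    refine LinearMap.ext fun W => (triv V).injective ?_
    rw [Module.End.mul_apply, autLift_apply, autLift_apply]
    have h := autLift_apply Y W
    have h₁ : (autLift Y W).1 = (Y.1 : V →L[ℝ] V) W.1 := congrArg Prod.fst h
    have h₂ : vec (autLift Y W) = vec Y W.1 + (Y.1 : V →L[ℝ] V) (vec W) :=
      congrArg Prod.snd h
    rw [h₁, h₂, mul_snd, dR_units, dL_units, mul_fst, map_add]
    refine Prod.ext rfl ?_
    exact add_assoc (vec X ((Y.1 : V →L[ℝ] V) W.1)) _ _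

variable {G : Type*} [TopologicalSpace G] [ChartedSpace H G] [Group G] [LieGroup I ∞ G]

/-- The tangent map of a homomorphism of Lie groups `G → Aut(V)` is a homomorphism. -/
def tangentHom (Φ : ContMDiffMonoidMorphism I 𝓘(ℝ, V →L[ℝ] V) ∞ G (V →L[ℝ] V)ˣ) :
    TangentBundle I G →* TangentBundle 𝓘(ℝ, V →L[ℝ] V) (V →L[ℝ] V)ˣ where
  toFun := tangentMap I 𝓘(ℝ, V →L[ℝ] V) (Φ : G → (V →L[ℝ] V)ˣ)
  map_one' := tangent_ext (map_one Φ.toMonoidHom)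
    (map_zero (mfderiv I 𝓘(ℝ, V →L[ℝ] V) (Φ : G → (V →L[ℝ] V)ˣ) 1))
  map_mul' X Y := by
    have hΦ : ∀ x, MDifferentiableAt I 𝓘(ℝ, V →L[ℝ] V) (Φ : G → (V →L[ℝ] V)ˣ) x := fun x =>
      Φ.contMDiff_toFun.mdifferentiable (by simp) x
    refine tangent_ext (map_mul Φ.toMonoidHom X.1 Y.1) ?_
    rw [mul_snd]
    let D : G → E →L[ℝ] (V →L[ℝ] V) := fun x => mfderiv I 𝓘(ℝ, V →L[ℝ] V) (Φ : G → (V →L[ℝ] V)ˣ) x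
    change D (X.1 * Y.1) (vec (X * Y)) =
      dR 𝓘(ℝ, V →L[ℝ] V) (Φ Y.1) (Φ X.1) (D X.1 (vec X)) +
      dL 𝓘(ℝ, V →L[ℝ] V) (Φ X.1) (Φ Y.1) (D Y.1 (vec Y))
    rw [mul_snd, map_add]
    congr 1
    · have h₁ := mfderiv_comp (I := I) (I' := I) (I'' := 𝓘(ℝ, V →L[ℝ] V)) X.1
        (hΦ (X.1 * Y.1)) (mdiff_mul_right (I := I) Y.1 X.1)
      have h₂ := mfderiv_comp (I := I) (I' := 𝓘(ℝ, V →L[ℝ] V)) (I'' := 𝓘(ℝ, V →L[ℝ] V)) X.1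
        (mdiff_mul_right (I := 𝓘(ℝ, V →L[ℝ] V)) (Φ Y.1) (Φ X.1)) (hΦ X.1)
      have e : (Φ : G → (V →L[ℝ] V)ˣ) ∘ (fun z : G => z * Y.1)
          = (fun b : (V →L[ℝ] V)ˣ => b * Φ Y.1) ∘ (Φ : G → (V →L[ℝ] V)ˣ) := by
        funext z; exact map_mul Φ.toMonoidHom z Y.1
      have h := h₁.symm.trans ((mfderiv_congr (I := I) (I' := 𝓘(ℝ, V →L[ℝ] V)) (x := X.1) e).trans h₂)
      exact congrArg (fun L : E →L[ℝ] (V →L[ℝ] V) => L X.2) h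
    · have h₁ := mfderiv_comp (I := I) (I' := I) (I'' := 𝓘(ℝ, V →L[ℝ] V)) Y.1
        (hΦ (X.1 * Y.1)) (mdiff_mul_left (I := I) X.1 Y.1)
      have h₂ := mfderiv_comp (I := I) (I' := 𝓘(ℝ, V →L[ℝ] V)) (I'' := 𝓘(ℝ, V →L[ℝ] V)) Y.1
        (mdiff_mul_left (I := 𝓘(ℝ, V →L[ℝ] V)) (Φ X.1) (Φ Y.1)) (hΦ Y.1)
      have e : (Φ : G → (V →L[ℝ] V)ˣ) ∘ (fun z : G => X.1 * z)
          = (fun b : (V →L[ℝ] V)ˣ => Φ X.1 * b) ∘ (Φ : G → (V →L[ℝ] V)ˣ) := by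
        funext z; exact map_mul Φ.toMonoidHom X.1 z
      have h := h₁.symm.trans ((mfderiv_congr (I := I) (I' := 𝓘(ℝ, V →L[ℝ] V)) (x := Y.1) e).trans h₂)
      exact congrArg (fun L : E →L[ℝ] (V →L[ℝ] V) => L Y.2) h

/-- A Lie group homomorphism `Φ : G → Aut(V)`, as a representation of `G` on `V`. -/
def toRep (Φ : ContMDiffMonoidMorphism I 𝓘(ℝ, V →L[ℝ] V) ∞ G (V →L[ℝ] V)ˣ) :
    Representation ℝ G V where
  toFun a := ((Φ a : (V →L[ℝ] V)ˣ) : V →L[ℝ] V).toLinearMap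
  map_one' := by
    rw [show Φ 1 = 1 from map_one Φ.toMonoidHom]; rfl
  map_mul' a b := by
    rw [show Φ (a * b) = Φ a * Φ b from map_mul Φ.toMonoidHom a b]; rfl

/-- The prolongation `J ∘ TΦ : TG → Aut(TV)` of `Φ : G → Aut(V)`, as a representation of the
group `TG` on the vector space `TV`. -/
def prolongation (Φ : ContMDiffMonoidMorphism I 𝓘(ℝ, V →L[ℝ] V) ∞ G (V →L[ℝ] V)ˣ) :
    Representation ℝ (TangentBundle I G) (TangentBundle 𝓘(ℝ, V) V) :=
  autLiftHom.comp (tangentHom Φ)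

end Prolong

/-- A representation is irreducible if its only invariant subspaces are `0` and the whole space. -/
def Irred {G W : Type*} [Group G] [AddCommGroup W] [Module ℝ W] (ρ : Representation ℝ G W) : Prop :=
  ∀ U : Submodule ℝ W, (∀ g : G, ∀ v ∈ U, ρ g v ∈ U) → U = ⊥ ∨ U = ⊤

/-- On nonzero spaces this is irreducibility in the sense of Mathlib. -/
theorem irred_iff {G W : Type*} [Group G] [AddCommGroup W] [Module ℝ W] [Nontrivial W]
    (ρ : Representation ℝ G W) : Irred ρ ↔ ρ.IsIrreducible := by
  constructor
  · intro h
    have : Nontrivial (Subrepresentation ρ) := ⟨⟨⊥, ⊤, fun e =>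
      bot_ne_top (α := Submodule ℝ W) (congrArg Subrepresentation.toSubmodule e)⟩⟩
    exact ⟨fun U => (h U.toSubmodule U.apply_mem_toSubmodule).imp
      (fun e => Subrepresentation.toSubmodule_injective e)
      (fun e => Subrepresentation.toSubmodule_injective e)⟩
  · intro h U hU
    exact (h.eq_bot_or_eq_top ⟨U, hU⟩).imp (congrArg Subrepresentation.toSubmodule)
      (congrArg Subrepresentation.toSubmodule)

/-! ### The rotation representation of the circle -/

/-- The operator `(x, y) ↦ (a x + b y, -b x + a y)` on `ℝ²`, for `z = a + i b`. -/
def rotCLM (z : ℂ) : ℝ × ℝ →L[ℝ] ℝ × ℝ :=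
  (z.re • ContinuousLinearMap.fst ℝ ℝ ℝ + z.im • ContinuousLinearMap.snd ℝ ℝ ℝ).prod
    (-z.im • ContinuousLinearMap.fst ℝ ℝ ℝ + z.re • ContinuousLinearMap.snd ℝ ℝ ℝ)

theorem rotCLM_apply (z : ℂ) (p : ℝ × ℝ) :
    rotCLM z p = (z.re * p.1 + z.im * p.2, -z.im * p.1 + z.re * p.2) := rfl

theorem rotCLM_one : rotCLM 1 = 1 := by
  refine ContinuousLinearMap.ext fun p => ?_
  rw [rotCLM_apply]
  simp

theorem rotCLM_mul (z w : ℂ) : rotCLM (z * w) = rotCLM z * rotCLM w := by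
  refine ContinuousLinearMap.ext fun p => ?_
  rw [mul_apply_eq_comp, rotCLM_apply, rotCLM_apply, rotCLM_apply]
  ext <;> simp <;> ring

/-- `Φ : S¹ → Aut(ℝ²)`, `Φ(a, b)(x, y) = (a x + b y, -b x + a y)`. -/
def rotation : ContMDiffMonoidMorphism (𝓡 1) 𝓘(ℝ, ℝ × ℝ →L[ℝ] ℝ × ℝ) ∞ Circle
    (ℝ × ℝ →L[ℝ] ℝ × ℝ)ˣ where
  toFun z := ⟨rotCLM z, rotCLM (z⁻¹ : Circle),
    by rw [← rotCLM_mul, ← Circle.coe_mul, mul_inv_cancel, Circle.coe_one, rotCLM_one],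
    by rw [← rotCLM_mul, ← Circle.coe_mul, inv_mul_cancel, Circle.coe_one, rotCLM_one]⟩
  map_one' := Units.ext (by simp [rotCLM_one])
  map_mul' z w := Units.ext (by simp [rotCLM_mul])
  contMDiff_toFun := by
    apply ContMDiff.of_comp_isOpenEmbedding Units.isOpenEmbedding_val
    have h : ContMDiff 𝓘(ℝ, ℂ) 𝓘(ℝ, ℝ × ℝ →L[ℝ] ℝ × ℝ) ∞ rotCLM := by
      rw [contMDiff_iff_contDiff]
      let L : ℂ →ₗ[ℝ] (ℝ × ℝ →L[ℝ] ℝ × ℝ) :=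
        { toFun := rotCLM
          map_add' := fun z w => by
            refine ContinuousLinearMap.ext fun p => ?_
            rw [_root_.add_apply, rotCLM_apply, rotCLM_apply, rotCLM_apply]
            ext <;> simp <;> ring
          map_smul' := fun c z => by
            refine ContinuousLinearMap.ext fun p => ?_
            rw [_root_.smul_apply, rotCLM_apply, rotCLM_apply]
            ext <;> simp <;> ring }
      exact L.toContinuousLinearMap.contDiff
    have := finrank_real_complex_fact'
    exact h.comp (contMDiff_coe_sphere (E := ℂ) (n := 1))

end Prolongation

end

namespace Prolongation

/-! ### Two kinds of subspaces of `TV`. -/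

section TangentSubspace

variable {V : Type*} [NormedAddCommGroup V] [NormedSpace ℝ V]

/-! In the trivialization `TV ≅ V × V`, a tangent vector `X` at `a` acts by `(p, q) ↦ (Φ(a) p, A p +
Φ(a) q)` with `A = TΦ(X)`, since `B Φ(a) = A`. Everything is read off from this block matrix.

If `U` is invariant under `Φ`, then so is `U × U` under the prolongation. The diagonal entries
preserve `U` by assumption; `A` does too, being the derivative of a family of operators that map `U`
into itself (`vec_tangentMap_apply_mem`). As `U × U` is zero or everything only if `U` is,
irreducibility passes from the prolongation to `Φ`.

The converse fails for every nonzero `V`: the matrix is block lower triangular, so `0 × V` is a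
proper nonzero invariant subspace (`not_irred_prolongation`). For the counterexample it remains to
see that the rotations act irreducibly: a nonzero vector and its quarter turn span the plane. -/

/-- The tangent bundle `TU ⊆ TV` of a linear subspace `U ⊆ V`. -/
noncomputable def tangentSubspace (U : Submodule ℝ V) : Submodule ℝ (TangentBundle 𝓘(ℝ, V) V) :=
  (U.prod U).comap (triv V).toLinearMap

theorem mem_tangentSubspace {U : Submodule ℝ V} {W : TangentBundle 𝓘(ℝ, V) V} :
    W ∈ tangentSubspace U ↔ W.1 ∈ U ∧ vec W ∈ U :=
  Iff.rfl

theorem tangentSubspace_eq_bot {U : Submodule ℝ V} (h : tangentSubspace U = ⊥) : U = ⊥ := by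
  refine (Submodule.eq_bot_iff U).2 fun u hu => ?_
  have hW : (triv V).symm (u, u) ∈ tangentSubspace U := ⟨hu, hu⟩
  rw [h, Submodule.mem_bot, LinearEquiv.map_eq_zero_iff] at hW
  exact congrArg Prod.fst hW

theorem tangentSubspace_eq_top {U : Submodule ℝ V} (h : tangentSubspace U = ⊤) : U = ⊤ := by
  refine Submodule.eq_top_iff'.2 fun u => ?_
  have hW : (triv V).symm (u, u) ∈ tangentSubspace U := h ▸ Submodule.mem_top
  exact hW.1

/-- The subspace of `TV` of the vertical vectors `T_0 V`. -/
noncomputable def verticalSubspace (V : Type*) [NormedAddCommGroup V] [NormedSpace ℝ V] :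
    Submodule ℝ (TangentBundle 𝓘(ℝ, V) V) :=
  ((⊥ : Submodule ℝ V).prod ⊤).comap (triv V).toLinearMap

theorem mem_verticalSubspace {W : TangentBundle 𝓘(ℝ, V) V} :
    W ∈ verticalSubspace V ↔ W.1 = 0 :=
  ⟨fun h => h.1, fun h => ⟨h, trivial⟩⟩

theorem verticalSubspace_ne_bot [Nontrivial V] : verticalSubspace V ≠ ⊥ := by
  intro h
  obtain ⟨v, hv⟩ := exists_ne (0 : V)
  have hW : (triv V).symm (0, v) ∈ verticalSubspace V := mem_verticalSubspace.2 rfl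
  rw [h, Submodule.mem_bot, LinearEquiv.map_eq_zero_iff] at hW
  exact hv (congrArg Prod.snd hW)

theorem verticalSubspace_ne_top [Nontrivial V] : verticalSubspace V ≠ ⊤ := by
  intro h
  obtain ⟨v, hv⟩ := exists_ne (0 : V)
  have hW : (triv V).symm (v, 0) ∈ verticalSubspace V := h ▸ Submodule.mem_top
  exact hv (mem_verticalSubspace.1 hW)

end TangentSubspace

/-! ### Invariance under the prolongation. -/

section Invariance

variable {V : Type*} [NormedAddCommGroup V] [NormedSpace ℝ V] [FiniteDimensional ℝ V]
  {E : Type*} [NormedAddCommGroup E] [NormedSpace ℝ E]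
  {H : Type*} [TopologicalSpace H] {I : ModelWithCorners ℝ E H}

/-- The derivative of a family of automorphisms that map `w` into a subspace `U` maps `w`
into `U`. -/
theorem vec_tangentMap_apply_mem {M : Type*} [TopologicalSpace M] [ChartedSpace H M]
    {f : M → (V →L[ℝ] V)ˣ} (X : TangentBundle I M)
    (hf : MDifferentiableAt I 𝓘(ℝ, V →L[ℝ] V) f X.1) {U : Submodule ℝ V} {w : V}
    (hU : ∀ y, (f y : V →L[ℝ] V) w ∈ U) :
    vec (tangentMap I 𝓘(ℝ, V →L[ℝ] V) f X) w ∈ U := by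
  -- `U` is the common kernel of the functionals `φ` that vanish on it. For each of them `y ↦ φ (f y
  -- w)` is identically zero, hence so is its derivative, which by the chain rule is `φ` applied to
  -- the derivative of `f` evaluated at `w`.
  rw [← Subspace.forall_mem_dualAnnihilator_apply_eq_zero_iff]
  intro φ hφ
  rw [Submodule.mem_dualAnnihilator] at hφ
  let L : (V →L[ℝ] V) →L[ℝ] ℝ :=
    φ.toContinuousLinearMap.comp (ContinuousLinearMap.apply ℝ V w)
  have hL : HasMFDerivAt 𝓘(ℝ, V →L[ℝ] V) 𝓘(ℝ, ℝ) L (f X.1 : V →L[ℝ] V) L :=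
    L.hasFDerivAt.hasMFDerivAt
  have h₁ := (HasMFDerivAt.comp X.1 hL
    (HasMFDerivAt.comp X.1 (mfderiv_unitsVal (f X.1)) hf.hasMFDerivAt)).mfderiv
  have e : L ∘ (Units.val ∘ f) = fun _ : M => (0 : ℝ) := by
    funext y
    exact hφ _ (hU y)
  have h₂ := h₁.symm.trans ((mfderiv_congr (I := I) (I' := 𝓘(ℝ, ℝ)) (x := X.1) e).trans
    (mfderiv_const (I := I) (I' := 𝓘(ℝ, ℝ))))
  exact congrArg (fun T : E →L[ℝ] ℝ => T X.2) h₂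

variable {G : Type*} [TopologicalSpace G] [ChartedSpace H G] [Group G] [LieGroup I ∞ G]
  (Φ : ContMDiffMonoidMorphism I 𝓘(ℝ, V →L[ℝ] V) ∞ G (V →L[ℝ] V)ˣ)

/-- The right translation by `Φ(a)⁻¹` in `B` cancels against the factor `Φ(a)`, so the lower left
entry is the plain derivative of `Φ`. -/
theorem triv_prolongation_apply (X : TangentBundle I G) (W : TangentBundle 𝓘(ℝ, V) V) :
    triv V (prolongation Φ X W) = ((Φ X.1 : V →L[ℝ] V) W.1,
      vec (tangentMap I 𝓘(ℝ, V →L[ℝ] V) (Φ : G → (V →L[ℝ] V)ˣ) X) W.1 +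
        (Φ X.1 : V →L[ℝ] V) (vec W)) :=
  autLift_apply (tangentMap I 𝓘(ℝ, V →L[ℝ] V) (Φ : G → (V →L[ℝ] V)ˣ) X) W

theorem prolongation_mem_tangentSubspace {U : Submodule ℝ V}
    (hU : ∀ g : G, ∀ v ∈ U, toRep Φ g v ∈ U) (X : TangentBundle I G)
    {W : TangentBundle 𝓘(ℝ, V) V} (hW : W ∈ tangentSubspace U) :
    prolongation Φ X W ∈ tangentSubspace U := by
  rw [mem_tangentSubspace] at hW
  change triv V (prolongation Φ X W) ∈ U.prod U
  rw [triv_prolongation_apply]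
  exact ⟨hU X.1 _ hW.1, U.add_mem
    (vec_tangentMap_apply_mem X (Φ.contMDiff_toFun.mdifferentiable (by simp) X.1)
      fun g => hU g _ hW.1)
    (hU X.1 _ hW.2)⟩

theorem irred_of_irred_prolongation (h : Irred (prolongation Φ)) : Irred (toRep Φ) :=
  fun U hU => (h (tangentSubspace U) fun X _ hW =>
    prolongation_mem_tangentSubspace Φ hU X hW).imp tangentSubspace_eq_bot tangentSubspace_eq_top

/-- The upper right block is zero: the base point of the image depends linearly on the base point of
`W` alone. -/
theorem prolongation_mem_verticalSubspace (X : TangentBundle I G)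
    {W : TangentBundle 𝓘(ℝ, V) V} (hW : W ∈ verticalSubspace V) :
    prolongation Φ X W ∈ verticalSubspace V := by
  rw [mem_verticalSubspace] at hW ⊢
  have h : (prolongation Φ X W).1 = (Φ X.1 : V →L[ℝ] V) W.1 :=
    congrArg Prod.fst (triv_prolongation_apply Φ X W)
  rw [h, hW, map_zero]

/-- No property of `Φ` enters. Only `V = 0` must be excluded, because `Irred` counts the zero space
as irreducible. -/
theorem not_irred_prolongation [Nontrivial V] : ¬ Irred (prolongation Φ) := fun h =>
  (h (verticalSubspace V) fun X _ hW => prolongation_mem_verticalSubspace Φ X hW).elim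
    verticalSubspace_ne_bot verticalSubspace_ne_top

end Invariance

/-! ### Irreducibility of the plane rotations. -/

theorem toRep_rotation_apply (z : Circle) (p : ℝ × ℝ) :
    toRep rotation z p =
      ((z : ℂ).re * p.1 + (z : ℂ).im * p.2, -(z : ℂ).im * p.1 + (z : ℂ).re * p.2) :=
  rfl

theorem irred_toRep_rotation : Irred (toRep rotation) := by
  intro U hU
  refine or_iff_not_imp_left.2 fun hne => ?_
  obtain ⟨⟨x, y⟩, hp, hp0⟩ := (Submodule.ne_bot_iff U).1 hne
  have hr : x ^ 2 + y ^ 2 ≠ 0 := by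
    intro h
    have hx : x = 0 := by nlinarith [sq_nonneg x, sq_nonneg y]
    have hy : y = 0 := by nlinarith [sq_nonneg x, sq_nonneg y]
    exact hp0 (by rw [hx, hy]; rfl)
  -- The point `(a, b) = (0, 1)` of the circle acts as a quarter turn, `(x, y) ↦ (y, -x)`.
  let i : Circle := ⟨Complex.I, by simp [Submonoid.unitSphere]⟩
  have hq : ((y, -x) : ℝ × ℝ) ∈ U := by
    have h := hU i _ hp
    rw [toRep_rotation_apply] at h
    simpa [i] using h
  refine Submodule.eq_top_iff'.2 fun ⟨u, v⟩ => ?_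
  -- `(x, y)` and `(y, -x)` are orthogonal, both of squared length `x ^ 2 + y ^ 2`. The coefficients
  -- of `(u, v)` are its inner products with them, divided by that length.
  have h := U.add_mem (U.smul_mem ((u * x + v * y) / (x ^ 2 + y ^ 2)) hp)
    (U.smul_mem ((u * y - v * x) / (x ^ 2 + y ^ 2)) hq)
  convert h using 1
  ext
  · simp only [Prod.fst_add, Prod.smul_fst, smul_eq_mul]
    field_simp
    ring
  · simp only [Prod.snd_add, Prod.smul_snd, smul_eq_mul]
    field_simp
    ring

end Prolongation

open Prolongation in
theorem corollary3p10
    {E : Type*} [NormedAddCommGroup E] [NormedSpace ℝ E] [FiniteDimensional ℝ E]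
    {H : Type*} [TopologicalSpace H] (I : ModelWithCorners ℝ E H)
    {G : Type*} [TopologicalSpace G] [ChartedSpace H G] [Group G] [LieGroup I ∞ G]
    {V : Type*} [NormedAddCommGroup V] [NormedSpace ℝ V] [FiniteDimensional ℝ V]
    (Φ : ContMDiffMonoidMorphism I 𝓘(ℝ, V →L[ℝ] V) ∞ G (V →L[ℝ] V)ˣ) :
    (Irred (prolongation Φ) → Irred (toRep Φ)) ∧
      (Irred (toRep rotation) ∧ ¬ Irred (prolongation rotation)) :=
  ⟨irred_of_irred_prolongation Φ, irred_toRep_rotation, not_irred_prolongation rotation⟩
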